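/- **Setting.** Let $n\ge 1$, let $\Omega\subset\mathbb R^n$ be a bounded domain (non-empty, open, connected), and let $\alpha,\beta\in(0,1)$ with $\alpha+\beta=1$, $\gamma\ge 0$, $\varepsilon>0$ with $\gamma\varepsilon^2<\tfrac12$. Put $$\Gamma_\varepsilon=\{x\in\mathbb R^n\setminus\Omega:\operatorname{dist}(x,\partial\Omega)\le\varepsilon\},\qquad \Omega_\varepsilon=\Omega\cup\Gamma_\varepsilon,$$ let $B_\varepsilon(x)$ denote the open ball of radius $\varepsilon$ about $x$, and $B_1$ the open unit ball about $0$. Let $F:\Gamma_\varepsilon\to\mathbb R$ be bounded and Borel measurable. A *solution of the DPP with boundary data $F$* is a bounded Borel function $u:\Omega_\varepsilon\to\mathbb R$ such that $u=F$ on $\Gamma_\varepsilon$ and, for every $x\in\Omega$, $$u(x)=(1-\gamma\varepsilon^2)\left\{\frac{\alpha}{2}\Big(\sup_{B_\varepsilon(x)}u+\inf_{B_\varepsilon(x)}u\Big)+\frac{\beta}{|B_\varepsilon(x)|}\int_{B_\varepsilon(x)}u(y)\,dy\right\}.$$ **The game.** A strategy $S$ of a player is a sequence of Borel functions $S^k$,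 $k\ge0$, which assign to each history $(x_0,(c_1,x_1),\dots,(c_k,x_k))$, with $c_i\in\{\mathrm I,\mathrm{II},0\}$ and $x_i\in\mathbb R^n$, a point of $B_1$. Let $\xi_0,w_0,\xi_1,w_1,\dots$ be independent random variables, each $\xi_k$ uniform on $[0,1]$ and each $w_k$ uniform on $B_1$. Given $x_0\in\Omega_\varepsilon$ and strategies $S_{\mathrm I},S_{\mathrm{II}}$, let $X_0=x_0$ and, for $k\ge0$, $$(c_{k+1},X_{k+1})=\begin{cases}(\mathrm I,\;X_k+\varepsilon\, s_{\mathrm I}^k)&\text{if }\xi_k<\alpha/2,\\(\mathrm{II},\;X_k+\varepsilon\, s_{\mathrm{II}}^k)&\text{if }\alpha/2\le\xi_k<\alpha,\\(0,\;X_k+\varepsilon\, w_k)&\text{if }\xi_k\ge\alpha,\end{cases}$$ where $s_j^k=S_j^k(x_0,(c_1,X_1),\dots,(c_k,X_k))$. Let $\tau=\min\{k\ge0:X_k\in\Gamma_\varepsilon\}$; Player II pays Player I the amount $(1-\gamma\varepsilon^2)^\tau F(X_\tau)$ (and $0$ if $\tau=\infty$). The value functions of the two players are, for $x_0\in\Omega_\varepsilon$,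 $$u_\varepsilon^{\mathrm I}(x_0)=\sup_{S_{\mathrm I}}\inf_{S_{\mathrm{II}}}\mathbb E^{x_0}_{S_{\mathrm I},S_{\mathrm{II}}}\big[(1-\gamma\varepsilon^2)^\tau F(X_\tau)\big],\qquad u_\varepsilon^{\mathrm{II}}(x_0)=\inf_{S_{\mathrm{II}}}\sup_{S_{\mathrm I}}\mathbb E^{x_0}_{S_{\mathrm I},S_{\mathrm{II}}}\big[(1-\gamma\varepsilon^2)^\tau F(X_\tau)\big].$$ **Theorem.** There is exactly one solution $u_\varepsilon$ of the DPP with boundary data $F$, and $$u_\varepsilon(x)=u_\varepsilon^{\mathrm I}(x)=u_\varepsilon^{\mathrm{II}}(x)\qquad\text{for every }x\in\Omega_\varepsilon.$$ In particular the discounted game has a value. -/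

import Mathlib

open MeasureTheory ProbabilityTheory Metric Set

namespace TugOfWar

/-- `n`-dimensional Euclidean space. -/
abbrev Space (n : ℕ) := EuclideanSpace ℝ (Fin n)

/-- The outer boundary strip of width `ε`: all points outside `Ω` at distance at most `ε`
from the boundary of `Ω`. -/
def strip {n : ℕ} (Ω : Set (Space n)) (ε : ℝ) : Set (Space n) :=
  {x | x ∉ Ω ∧ infDist x (frontier Ω) ≤ ε}

/-- The extended domain: `Ω` together with its boundary strip. -/
def extDomain {n : ℕ} (Ω : Set (Space n)) (ε : ℝ) : Set (Space n) :=
  Ω ∪ strip Ω ε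

/-! ### The dynamic programming principle -/

/-- `u` is a bounded Borel function on the extended domain which satisfies the dynamic programming
principle in `Ω` and equals `F` on the boundary strip. For `x ∈ Ω` the open ball `ball x ε` lies in
the extended domain, so the values of `u` elsewhere play no role. -/
structure IsDPPSolution {n : ℕ} (Ω : Set (Space n)) (F : Space n → ℝ) (α β γ ε : ℝ)
    (u : Space n → ℝ) : Prop where
  measurable : Measurable (fun x : extDomain Ω ε => u x)
  bounded : ∃ C : ℝ, ∀ x ∈ extDomain Ω ε, |u x| ≤ C
  dpp : ∀ x ∈ Ω, u x = (1 - γ * ε ^ 2) *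
    (α / 2 * (sSup (u '' ball x ε) + sInf (u '' ball x ε)) + β * ⨍ y in ball x ε, u y)
  boundary : ∀ x ∈ strip Ω ε, u x = F x

/-! ### Histories and strategies -/

/-- The result of a round: Player I moves, Player II moves, or the token moves at random. -/
inductive Toss where
  | playerI
  | playerII
  | random

instance : MeasurableSpace Toss := ⊤

/-- Histories `(x₀, (c₁, x₁), …, (c_k, x_k))` of `k` rounds. -/
abbrev History (n k : ℕ) := Space n × (Fin k → Toss × Space n)

/-- The last position `x_k` of the token in a history of `k` rounds. -/
def History.last {n : ℕ} : {k : ℕ} → History n k → Space n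
  | 0, h => h.1
  | k + 1, h => (h.2 (Fin.last k)).2

/-- A strategy: for each `k`, a Borel function of the history of the first `k` rounds with values
in the open unit ball. -/
structure Strategy (n : ℕ) where
  move : (k : ℕ) → History n k → Space n
  measurable_move : ∀ k, Measurable (move k)
  move_mem : ∀ k h, move k h ∈ ball (0 : Space n) 1

/-! ### The random inputs -/

/-- The uniform distribution on the interval `[0, 1]` (normalized Lebesgue measure). -/
noncomputable def uniformInterval : Measure ℝ := cond volume (Icc (0 : ℝ) 1)

/-- The uniform distribution on the open unit ball (normalized Lebesgue measure). -/
noncomputable def uniformBall (n : ℕ) : Measure (Space n) := cond volume (ball (0 : Space n) 1)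

instance : IsProbabilityMeasure uniformInterval :=
  cond_isProbabilityMeasure_of_finite (by simp) (by simp)

instance (n : ℕ) : IsProbabilityMeasure (uniformBall n) :=
  cond_isProbabilityMeasure_of_finite (measure_ball_pos _ _ one_pos).ne' measure_ball_lt_top.ne

/-- The sample space: sequences of pairs `(ξ, w)`, the pair with index `k` being used to move the
token from position number `k` to position number `k + 1`. -/
abbrev Sample (n : ℕ) := ℕ → ℝ × Space n

/-- The law of the random inputs: all `ξ` and `w` are independent, each `ξ` is uniform on `[0, 1]`
and each `w` is uniform on the unit ball. -/
noncomputable def sampleLaw (n : ℕ) : Measure (Sample n) :=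
  Measure.infinitePi fun _ => uniformInterval.prod (uniformBall n)

/-! ### The game -/

/-- The result of a round in which the uniform random number is `ξ`. -/
noncomputable def toss (α ξ : ℝ) : Toss :=
  if ξ < α / 2 then .playerI else if ξ < α then .playerII else .random

/-- The displacement of the token, in units of `ε`, in the round after the history `h`, when the
result of the round is `c` and the random vector is `w`. -/
def step {n : ℕ} (SI SII : Strategy n) {k : ℕ} (h : History n k) (c : Toss) (w : Space n) :
    Space n :=
  match c with
  | .playerI => SI.move k h
  | .playerII => SII.move k h
  | .random => w

/-- The history of the first `k` rounds of the game started at `x₀`. -/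
noncomputable def history {n : ℕ} (α ε : ℝ) (SI SII : Strategy n) (x₀ : Space n) (ω : Sample n) :
    (k : ℕ) → History n k
  | 0 => (x₀, Fin.elim0)
  | k + 1 =>
    let h := history α ε SI SII x₀ ω k
    let c := toss α (ω k).1
    (x₀, Fin.snoc (α := fun _ => Toss × Space n) h.2 (c, h.last + ε • step SI SII h c (ω k).2))

/-- The position `X_k` of the token after `k` rounds. -/
noncomputable def position {n : ℕ} (α ε : ℝ) (SI SII : Strategy n) (x₀ : Space n) (ω : Sample n)
    (k : ℕ) : Space n :=
  (history α ε SI SII x₀ ω k).last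

open Classical in
/-- The discounted payoff `(1 - γ ε²)^τ F(X_τ)`, where `τ` is the least `k ≥ 0` such that `X_k` lies
in the boundary strip; nothing is paid if there is no such `k`. -/
noncomputable def payoff {n : ℕ} (Ω : Set (Space n)) (F : Space n → ℝ) (α γ ε : ℝ)
    (SI SII : Strategy n) (x₀ : Space n) (ω : Sample n) : ℝ :=
  if h : ∃ k, position α ε SI SII x₀ ω k ∈ strip Ω ε then
    (1 - γ * ε ^ 2) ^ Nat.find h * F (position α ε SI SII x₀ ω (Nat.find h))
  else 0

/-- The expected discounted payoff of the game started at `x₀` with strategies `SI`, `SII`. -/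
noncomputable def expectedPayoff {n : ℕ} (Ω : Set (Space n)) (F : Space n → ℝ) (α γ ε : ℝ)
    (SI SII : Strategy n) (x₀ : Space n) : ℝ :=
  ∫ ω, payoff Ω F α γ ε SI SII x₀ ω ∂(sampleLaw n)

/-- The value function for Player I. -/
noncomputable def valueI {n : ℕ} (Ω : Set (Space n)) (F : Space n → ℝ) (α γ ε : ℝ)
    (x₀ : Space n) : ℝ :=
  ⨆ SI : Strategy n, ⨅ SII : Strategy n, expectedPayoff Ω F α γ ε SI SII x₀

/-- The value function for Player II. -/
noncomputable def valueII {n : ℕ} (Ω : Set (Space n)) (F : Space n → ℝ) (α γ ε : ℝ)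
    (x₀ : Space n) : ℝ :=
  ⨅ SII : Strategy n, ⨆ SI : Strategy n, expectedPayoff Ω F α γ ε SI SII x₀

end TugOfWar

namespace TugOfWar

variable {n : ℕ}

/-! Existence comes from monotone iteration, and uniqueness from the game: every bounded Borel
solution equals both value functions, which depend on the data alone.

Since `γ = 0` is allowed, the discount gives no contraction. Iterating the DPP upwards from `-C`
yields an increasing sequence `U k` with pointwise limit `u`, but infima over balls need not commute
with such limits. The convergence is in fact uniform: the average part of the error is at most a
multiple of the integral of `u - U k` over `Ω`, which tends to zero by dominated convergence, while
the sup/inf part carries the weight `α < 1`. So the limit `σ` of the sup-distances satisfies `σ ≤ α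
σ`, hence vanishes (`exists_dppOp_fixed_point`).

For the values, let one player always move to a nearly optimal point for a solution `v`, with
summable errors. Against any opponent, `l ^ k * v X_k`, stopped on leaving `Ω`, is then a super- or
submartingale up to these errors. Since `β > 0`, a long enough run of random moves in one direction
occurs almost surely and drives the token out of the bounded set `Ω`, so the stopped process
converges to the payoff (`expectedPayoff_le`). The strategies must be Borel;
`exists_measurable_near_sSup` supplies them. -/

lemma bddAbove_image_of_abs_le {X : Type*} {u : X → ℝ} {C : ℝ} (hu : ∀ x, |u x| ≤ C) (s : Set X) :
    BddAbove (u '' s) :=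
  ⟨C, by rintro _ ⟨y, -, rfl⟩; exact (abs_le.1 (hu y)).2⟩

lemma bddBelow_image_of_abs_le {X : Type*} {u : X → ℝ} {C : ℝ} (hu : ∀ x, |u x| ≤ C) (s : Set X) :
    BddBelow (u '' s) :=
  ⟨-C, by rintro _ ⟨y, -, rfl⟩; exact (abs_le.1 (hu y)).1⟩

lemma sSup_neg_image {X : Type*} (u : X → ℝ) (s : Set X) :
    sSup ((fun y => -u y) '' s) = -sInf (u '' s) := by
  rw [← Real.sSup_neg, ← image_neg_eq_neg, image_image]

/-! ### Borel measurability of suprema, infima and averages over balls -/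

/-- A superlevel set is a union of open balls, centred at the points where `u` exceeds the level. It
is therefore open, whether or not `u` is Borel. -/
lemma measurable_sSup_image_ball {u : Space n → ℝ} {C ε : ℝ} (hε : 0 < ε) (hu : ∀ x, |u x| ≤ C) :
    Measurable fun x => sSup (u '' ball x ε) := by
  refine measurable_of_Ioi fun c => IsOpen.measurableSet ?_
  have : (fun x => sSup (u '' ball x ε)) ⁻¹' Ioi c = ⋃ y ∈ {y | c < u y}, ball y ε := by
    ext x
    simp only [mem_preimage, mem_Ioi, mem_iUnion, mem_ofPred_eq, exists_prop]
    rw [lt_csSup_iff (bddAbove_image_of_abs_le hu _) ((nonempty_ball.2 hε).image _)]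
    simp only [mem_image, exists_exists_and_eq_and]
    exact exists_congr fun y => by rw [mem_ball_comm, and_comm]
  rw [this]
  exact isOpen_biUnion fun _ _ => isOpen_ball

lemma measurable_sInf_image_ball {u : Space n → ℝ} {C ε : ℝ} (hε : 0 < ε) (hu : ∀ x, |u x| ≤ C) :
    Measurable fun x => sInf (u '' ball x ε) := by
  have := (measurable_sSup_image_ball (u := fun y => -u y) hε (fun x => by simpa using hu x)).neg
  simpa only [sSup_neg_image, Pi.neg_def, neg_neg] using this

/-- Affine change of variables. It identifies the average in the DPP with the expectation over one
random move. -/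
lemma setAverage_ball_eq (u : Space n → ℝ) (x : Space n) {ε : ℝ} (hε : 0 < ε) :
    ⨍ y in ball x ε, u y = ∫ w, u (x + ε • w) ∂(uniformBall n) := by
  have h1 : ∫ w in ball (0 : Space n) 1, u (x + ε • w) =
      (ε ^ n)⁻¹ * ∫ y in ball x ε, u y := by
    have h2 := Measure.setIntegral_comp_smul_of_pos (volume : Measure (Space n))
      (fun y => u (x + y)) (ball 0 1) hε
    have h3 : ∫ y in ball (0 : Space n) ε, u (x + y) = ∫ y in ball x ε, u y := by
      have := (measurePreserving_add_left (volume : Measure (Space n)) x).setIntegral_preimage_emb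
        (measurableEmbedding_addLeft x) u (ball x ε)
      rwa [preimage_add_left_ball, neg_add_cancel] at this
    rw [h2, smul_unitBall_of_pos hε, h3]
    simp
  rw [uniformBall, ProbabilityTheory.cond, integral_smul_measure, h1, setAverage_eq, Measure.real,
    Measure.addHaar_ball_of_pos _ _ hε]
  simp only [finrank_euclideanSpace, Fintype.card_fin, ENNReal.toReal_mul, ENNReal.toReal_inv,
    ENNReal.toReal_ofReal (pow_nonneg hε.le n), smul_eq_mul, mul_inv]
  ring

lemma measurable_setAverage_ball {u : Space n → ℝ} {ε : ℝ} (hε : 0 < ε) (hu : Measurable u) :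
    Measurable fun x => ⨍ y in ball x ε, u y := by
  simp only [setAverage_ball_eq u _ hε]
  have : StronglyMeasurable (fun p : Space n × Space n => u (p.1 + ε • p.2)) := by
    apply Measurable.stronglyMeasurable; fun_prop
  exact this.integral_prod_right.measurable

lemma integrable_of_abs_le {X : Type*} [MeasurableSpace X] {μ : Measure X} [IsFiniteMeasure μ]
    {f : X → ℝ} {C : ℝ} (hf : Measurable f) (hC : ∀ x, |f x| ≤ C) : Integrable f μ :=
  Integrable.of_bound hf.aestronglyMeasurable C (Filter.Eventually.of_forall hC)

/-! ### Borel selection of nearly optimal moves -/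

/-- Countably many points realize the suprema of a function over all balls of a given radius. -/
lemma exists_seq_lt_of_lt_sSup {u : Space n → ℝ} {C ε : ℝ} (hε : 0 < ε) (hu : ∀ x, |u x| ≤ C) :
    ∃ d : ℕ → Space n, ∀ x, ∀ c < sSup (u '' ball x ε), ∃ i, d i ∈ ball x ε ∧ c < u (d i) := by
  -- Lindelöf: for each rational level, countably many of the balls centred in the superlevel set
  -- already cover their union.
  have key : ∀ q : ℚ, ∃ T : Set (Space n), T.Countable ∧ T ⊆ {y | (q : ℝ) < u y} ∧
      ⋃ y ∈ T, ball y ε = ⋃ y ∈ {y | (q : ℝ) < u y}, ball y ε := fun q => by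
    obtain ⟨T, h1, h2, h3⟩ := TopologicalSpace.isOpen_biUnion_countable
      {y | (q : ℝ) < u y} (fun y => ball y ε) (fun _ _ => isOpen_ball)
    exact ⟨T, h2, h1, h3⟩
  choose T hT hTu hTeq using key
  -- The extra point `0` makes the set nonempty, so that it can be enumerated by `ℕ`.
  have hc : (insert 0 (⋃ q, T q)).Countable := (countable_iUnion hT).insert 0
  obtain ⟨d, hd⟩ := hc.exists_eq_range ⟨0, mem_insert _ _⟩
  refine ⟨d, fun x c hlt => ?_⟩
  obtain ⟨q, hq1, hq2⟩ := exists_rat_btwn hlt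
  rw [lt_csSup_iff (bddAbove_image_of_abs_le hu _) ((nonempty_ball.2 hε).image _)] at hq2
  obtain ⟨_, ⟨y, hy, rfl⟩, hyq⟩ := hq2
  have : x ∈ ⋃ y ∈ {y | (q : ℝ) < u y}, ball y ε :=
    mem_biUnion (show y ∈ {y | (q : ℝ) < u y} from hyq) (mem_ball_comm.1 hy)
  rw [← hTeq q] at this
  obtain ⟨z, hz, hxz⟩ := mem_iUnion₂.1 this
  have hz' : z ∈ range d := hd ▸ mem_insert_of_mem _ (mem_iUnion.2 ⟨q, hz⟩)
  obtain ⟨i, rfl⟩ := hz'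
  exact ⟨i, mem_ball_comm.1 hxz, hq1.trans (hTu q hz)⟩

/-- A Borel selection of nearly maximal points. -/
lemma exists_measurable_near_sSup {u : Space n → ℝ} {C ε η : ℝ} (hε : 0 < ε) (hη : 0 < η)
    (hu : ∀ x, |u x| ≤ C) :
    ∃ f : Space n → Space n, Measurable f ∧ (∀ x, f x ∈ ball (0 : Space n) 1) ∧
      ∀ x, sSup (u '' ball x ε) - η ≤ u (x + ε • f x) := by
  obtain ⟨d, hd⟩ := exists_seq_lt_of_lt_sSup hε hu
  classical
  have hex : ∀ x, ∃ i, d i ∈ ball x ε ∧ sSup (u '' ball x ε) - η < u (d i) := fun x =>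
    hd x _ (sub_lt_self _ hη)
  -- Choosing the least admissible index keeps the selection Borel.
  have hmi : Measurable fun x => Nat.find (hex x) := by
    refine measurable_find hex fun i => ?_
    refine MeasurableSet.inter ?_ ?_
    · exact (measurableSet_ball : MeasurableSet (ball (d i) ε)).congr
        (by ext x; exact mem_ball_comm)
    · exact measurableSet_lt ((measurable_sSup_image_ball hε hu).sub_const η) measurable_const
  refine ⟨fun x => ε⁻¹ • (d (Nat.find (hex x)) - x), ?_, fun x => ?_, fun x => ?_⟩
  · have hd' : Measurable fun x => d (Nat.find (hex x)) := (measurable_of_countable d).comp hmi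
    fun_prop
  · have := (Nat.find_spec (hex x)).1
    rw [mem_ball, dist_eq_norm] at this
    rw [mem_ball_zero_iff, norm_smul, norm_inv, Real.norm_of_nonneg hε.le, inv_mul_lt_iff₀ hε]
    simpa using this
  · rw [smul_inv_smul₀ hε.ne', add_sub_cancel]
    exact (Nat.find_spec (hex x)).2.le

/-! ### The one-step operator -/

/-- The undiscounted right-hand side of the dynamic programming principle. -/
noncomputable def dppOp (α β ε : ℝ) (u : Space n → ℝ) (x : Space n) : ℝ :=
  α / 2 * (sSup (u '' ball x ε) + sInf (u '' ball x ε)) + β * ⨍ y in ball x ε, u y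

lemma measurable_dppOp {α β ε C : ℝ} {u : Space n → ℝ} (hε : 0 < ε) (hum : Measurable u)
    (hu : ∀ x, |u x| ≤ C) : Measurable (dppOp α β ε u) :=
  (((measurable_sSup_image_ball hε hu).add (measurable_sInf_image_ball hε hu)).const_mul _).add
    ((measurable_setAverage_ball hε hum).const_mul _)

lemma setAverage_ball_le {ε C D s : ℝ} {u v : Space n → ℝ} (hε : 0 < ε) (hum : Measurable u)
    (hvm : Measurable v) (hu : ∀ x, |u x| ≤ C) (hv : ∀ x, |v x| ≤ D) (huv : ∀ x, u x ≤ v x + s)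
    (x : Space n) : ⨍ y in ball x ε, u y ≤ (⨍ y in ball x ε, v y) + s := by
  have hiu : Integrable (fun w => u (x + ε • w)) (uniformBall n) :=
    integrable_of_abs_le (by fun_prop) fun _ => hu _
  have hiv : Integrable (fun w => v (x + ε • w)) (uniformBall n) :=
    integrable_of_abs_le (by fun_prop) fun _ => hv _
  rw [setAverage_ball_eq _ _ hε, setAverage_ball_eq _ _ hε]
  calc _ ≤ ∫ w, (v (x + ε • w) + s) ∂(uniformBall n) :=
        integral_mono hiu (hiv.add (integrable_const s)) fun _ => huv _
    _ = _ := by rw [integral_add hiv (integrable_const s)]; simp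

/-- The errors of the sup/inf part and of the average are kept apart: in the existence proof the
second tends to zero by itself, and only the first has to be contracted by `α`. -/
lemma dppOp_le_add {α β ε C D s e : ℝ} {u v : Space n → ℝ} (hα : 0 ≤ α) (hβ : 0 ≤ β)
    (hε : 0 < ε) (hu : ∀ x, |u x| ≤ C) (hv : ∀ x, |v x| ≤ D) (huv : ∀ x, u x ≤ v x + s)
    (x : Space n) (he : ⨍ y in ball x ε, u y ≤ (⨍ y in ball x ε, v y) + e) :
    dppOp α β ε u x ≤ dppOp α β ε v x + (α * s + β * e) := by
  have hne {w : Space n → ℝ} : (w '' ball x ε).Nonempty := (nonempty_ball.2 hε).image _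
  have h1 : sSup (u '' ball x ε) ≤ sSup (v '' ball x ε) + s := by
    refine csSup_le hne ?_
    rintro _ ⟨y, hy, rfl⟩
    have := le_csSup (bddAbove_image_of_abs_le hv (ball x ε)) (mem_image_of_mem v hy)
    linarith [huv y]
  have h2 : sInf (u '' ball x ε) - s ≤ sInf (v '' ball x ε) := by
    refine le_csInf hne ?_
    rintro _ ⟨y, hy, rfl⟩
    have := csInf_le (bddBelow_image_of_abs_le hu (ball x ε)) (mem_image_of_mem u hy)
    linarith [huv y]
  have h3 := mul_le_mul_of_nonneg_left (add_le_add h1 (sub_le_iff_le_add.1 h2))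
    (div_nonneg hα zero_le_two)
  have h4 := mul_le_mul_of_nonneg_left he hβ
  unfold dppOp
  linarith

lemma dppOp_const {α β ε c : ℝ} (hαβ : α + β = 1) (hε : 0 < ε) (x : Space n) :
    dppOp α β ε (fun _ => c) x = c := by
  have hne : (ball x ε).Nonempty := nonempty_ball.2 hε
  rw [dppOp, setAverage_ball_eq _ _ hε, hne.image_const]
  simp only [csSup_singleton, csInf_singleton, integral_const, probReal_univ, one_smul]
  linear_combination c * hαβ

/-- Comparison with the constants `C` and `-C`, which the operator fixes because the weights sum to
one. -/
lemma abs_dppOp_le {α β ε C : ℝ} {u : Space n → ℝ} (hα : 0 ≤ α) (hβ : 0 ≤ β) (hαβ : α + β = 1)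
    (hε : 0 < ε) (hum : Measurable u) (hu : ∀ x, |u x| ≤ C) (x : Space n) :
    |dppOp α β ε u x| ≤ C := by
  have hc (c : ℝ) : ∀ x : Space n, |(fun _ => c) x| ≤ |c| := fun _ => le_rfl
  have h1 : ∀ x, u x ≤ (fun _ => C) x + 0 := fun x => by simpa using (abs_le.1 (hu x)).2
  have h2 : ∀ x, (fun _ => -C) x ≤ u x + 0 := fun x => by simpa using (abs_le.1 (hu x)).1
  have h3 := dppOp_le_add hα hβ hε hu (hc C) h1 x
    (setAverage_ball_le hε hum measurable_const hu (hc C) h1 x)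
  have h4 := dppOp_le_add hα hβ hε (hc (-C)) hu h2 x
    (setAverage_ball_le hε measurable_const hum (hc (-C)) hu h2 x)
  rw [dppOp_const hαβ hε] at h3 h4
  exact abs_le.2 ⟨by linarith, by linarith⟩

/-! ### Existence by monotone iteration -/

open Classical in
/-- The iteration which starts from the constant `-C` in `Ω`, with boundary data `G`. -/
noncomputable def dppIter (Ω : Set (Space n)) (G : Space n → ℝ) (α β ε l C : ℝ) :
    ℕ → Space n → ℝ
  | 0 => Ω.piecewise (fun _ => -C) G
  | k + 1 => Ω.piecewise (fun x => l * dppOp α β ε (dppIter Ω G α β ε l C k) x) G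

section Existence

variable {Ω : Set (Space n)} {G : Space n → ℝ} {α β ε l C : ℝ}

lemma dppIter_of_notMem (k : ℕ) {x : Space n} (hx : x ∉ Ω) :
    dppIter Ω G α β ε l C k x = G x := by
  cases k <;> simp [dppIter, hx]

lemma dppIter_succ_of_mem (k : ℕ) {x : Space n} (hx : x ∈ Ω) :
    dppIter Ω G α β ε l C (k + 1) x = l * dppOp α β ε (dppIter Ω G α β ε l C k) x := by
  simp [dppIter, hx]

lemma dppIter_measurable_and_abs_le (hΩ : MeasurableSet Ω) (hα : 0 ≤ α) (hβ : 0 ≤ β)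
    (hαβ : α + β = 1) (hε : 0 < ε) (hl : 0 ≤ l) (hl1 : l ≤ 1) (hGm : Measurable G)
    (hG : ∀ x, |G x| ≤ C) (k : ℕ) :
    Measurable (dppIter Ω G α β ε l C k) ∧ ∀ x, |dppIter Ω G α β ε l C k x| ≤ C := by
  have hC : 0 ≤ C := (abs_nonneg _).trans (hG 0)
  induction k with
  | zero =>
    refine ⟨measurable_const.piecewise hΩ hGm, fun x => ?_⟩
    by_cases hx : x ∈ Ω
    · simp [dppIter, hx, abs_of_nonneg hC]
    · simp [dppIter, hx, hG x]
  | succ k ih =>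
    refine ⟨((measurable_dppOp hε ih.1 ih.2).const_mul l).piecewise hΩ hGm, fun x => ?_⟩
    by_cases hx : x ∈ Ω
    · rw [dppIter_succ_of_mem k hx, abs_mul, abs_of_nonneg hl]
      calc l * _ ≤ 1 * C := mul_le_mul hl1 (abs_dppOp_le hα hβ hαβ hε ih.1 ih.2 x)
            (abs_nonneg _) zero_le_one
        _ = C := one_mul C
    · rw [dppIter_of_notMem _ hx]
      exact hG x

/-- The iteration starts at the least value allowed in `Ω`, so its first step goes up; monotonicity
of the operator propagates this. -/
lemma dppIter_monotone (hΩ : MeasurableSet Ω) (hα : 0 ≤ α) (hβ : 0 ≤ β)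
    (hαβ : α + β = 1) (hε : 0 < ε) (hl : 0 ≤ l) (hl1 : l ≤ 1) (hGm : Measurable G)
    (hG : ∀ x, |G x| ≤ C) : Monotone (dppIter Ω G α β ε l C) := by
  have hb := dppIter_measurable_and_abs_le hΩ hα hβ hαβ hε hl hl1 hGm hG
  refine monotone_nat_of_le_succ fun k => ?_
  induction k with
  | zero =>
    intro x
    by_cases hx : x ∈ Ω
    · have h := (abs_le.1 ((hb 1).2 x)).1
      simpa [dppIter, hx] using h
    · rw [dppIter_of_notMem _ hx, dppIter_of_notMem _ hx]
  | succ k ih =>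
    intro x
    by_cases hx : x ∈ Ω
    · rw [dppIter_succ_of_mem _ hx, dppIter_succ_of_mem _ hx]
      have ih' := fun x => (ih x).trans_eq (add_zero _).symm
      have := dppOp_le_add hα hβ hε (hb k).2 (hb (k + 1)).2 ih' x
        (setAverage_ball_le hε (hb k).1 (hb (k + 1)).1 (hb k).2 (hb (k + 1)).2 ih' x)
      exact mul_le_mul_of_nonneg_left (by linarith) hl
    · rw [dppIter_of_notMem _ hx, dppIter_of_notMem _ hx]

/-- Existence of a bounded Borel solution of the dynamic programming principle. -/
theorem exists_dppOp_fixed_point (hΩ : MeasurableSet Ω) (hΩb : Bornology.IsBounded Ω) (hα : 0 ≤ α)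
    (hβ : 0 < β) (hαβ : α + β = 1) (hε : 0 < ε) (hl : 0 ≤ l) (hl1 : l ≤ 1) (hGm : Measurable G)
    (hG : ∀ x, |G x| ≤ C) :
    ∃ u : Space n → ℝ, Measurable u ∧ (∀ x, |u x| ≤ C) ∧
      (∀ x ∈ Ω, u x = l * dppOp α β ε u x) ∧ ∀ x ∉ Ω, u x = G x := by
  have hb := dppIter_measurable_and_abs_le hΩ hα hβ.le hαβ hε hl hl1 hGm hG
  have hmono := dppIter_monotone hΩ hα hβ.le hαβ hε hl hl1 hGm hG
  have hsuccΩ := fun k x (hx : x ∈ Ω) =>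
    dppIter_succ_of_mem (G := G) (α := α) (β := β) (ε := ε) (l := l) (C := C) k hx
  have hoff := fun k x (hx : x ∉ Ω) =>
    dppIter_of_notMem (G := G) (α := α) (β := β) (ε := ε) (l := l) (C := C) k hx
  set U := dppIter Ω G α β ε l C
  have hC : 0 ≤ C := (abs_nonneg _).trans (hG 0)
  have hbdd : ∀ x, BddAbove (range fun k => U k x) := fun x =>
    ⟨C, by rintro _ ⟨k, rfl⟩; exact (abs_le.1 ((hb k).2 x)).2⟩
  set u : Space n → ℝ := fun x => ⨆ k, U k x
  have hlim : ∀ x, Filter.Tendsto (fun k => U k x) Filter.atTop (nhds (u x)) := fun x =>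
    tendsto_atTop_ciSup (fun i j hij => hmono hij x) (hbdd x)
  have hum : Measurable u := measurable_of_tendsto_metrizable (fun k => (hb k).1)
    (tendsto_pi_nhds.2 hlim)
  have hle : ∀ k x, U k x ≤ u x := fun k x => le_ciSup (hbdd x) k
  have huC : ∀ x, |u x| ≤ C := fun x => abs_le.2
    ⟨(abs_le.1 ((hb 0).2 x)).1.trans (hle 0 x), ciSup_le fun k => (abs_le.1 ((hb k).2 x)).2⟩
  have hdiff : ∀ k x, |u x - U k x| ≤ 2 * C := fun k x => by
    have h1 := abs_le.1 (huC x)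
    have h2 := abs_le.1 ((hb k).2 x)
    exact abs_le.2 ⟨by linarith, by linarith⟩
  have huoff : ∀ x ∉ Ω, u x = G x := fun x hx => by
    have := hlim x
    simp only [hoff _ x hx] at this
    exact tendsto_nhds_unique this tendsto_const_nhds
  -- the uniform distance
  have hsb : ∀ k, BddAbove (range fun x => u x - U k x) := fun k =>
    ⟨2 * C, by rintro _ ⟨x, rfl⟩; exact (abs_le.1 (hdiff k x)).2⟩
  set s : ℕ → ℝ := fun k => ⨆ x, (u x - U k x)
  have hs : ∀ k x, u x ≤ U k x + s k := fun k x => by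
    have := le_ciSup (hsb k) x
    change u x - U k x ≤ s k at this
    linarith
  have hs0 : ∀ k, 0 ≤ s k := fun k => by linarith [hs k 0, hle k 0]
  have hsanti : Antitone s := fun i j hij => ciSup_le fun x => by
    have := hmono hij x
    linarith [hs i x]
  -- the averages
  set e : ℕ → ℝ := fun k => (volume.real (ball (0 : Space n) ε))⁻¹ * ∫ y in Ω, (u y - U k y)
  have hfin : IsFiniteMeasure (volume.restrict Ω) := ⟨by
    rw [Measure.restrict_apply_univ]; exact hΩb.measure_lt_top⟩
  have he0 : Filter.Tendsto e Filter.atTop (nhds 0) := by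
    have : Filter.Tendsto (fun k => ∫ y in Ω, (u y - U k y)) Filter.atTop
        (nhds (∫ y in Ω, (0 : ℝ))) := by
      refine tendsto_integral_of_dominated_convergence (fun _ => 2 * C)
        (fun k => (hum.sub (hb k).1).aestronglyMeasurable) (integrable_const _)
        (fun k => Filter.Eventually.of_forall (hdiff k)) (Filter.Eventually.of_forall fun y => ?_)
      simpa using (hlim y).const_sub (u y)
    simpa using this.const_mul (volume.real (ball (0 : Space n) ε))⁻¹
  have hav : ∀ j k x, ⨍ y in ball x ε, U j y ≤ (⨍ y in ball x ε, U k y) + e k := by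
    intro j k x
    have h1 := setAverage_ball_le hε (hb j).1 hum (hb j).2 huC
      (fun x => (hle j x).trans_eq (add_zero _).symm) x
    have hfb : IsFiniteMeasure (volume.restrict (ball x ε)) := ⟨by
      rw [Measure.restrict_apply_univ]; exact measure_ball_lt_top⟩
    -- The integrand is nonnegative and vanishes off `Ω`, where both functions equal `G`. This makes
    -- the bound independent of `x`.
    have h2 : ∫ y in ball x ε, (u y - U k y) ≤ ∫ y in Ω, (u y - U k y) := by
      rw [← integral_indicator measurableSet_ball, ← integral_indicator hΩ]
      refine integral_mono_of_nonneg (Filter.Eventually.of_forall fun y => ?_) ?_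
        (Filter.Eventually.of_forall fun y => ?_)
      · exact indicator_nonneg (fun y _ => sub_nonneg.2 (hle k y)) y
      · rw [integrable_indicator_iff hΩ]
        exact integrable_of_abs_le (hum.sub (hb k).1) (hdiff k)
      · by_cases hy : y ∈ Ω
        · rw [indicator_of_mem hy]
          exact indicator_le_self' (fun _ _ => sub_nonneg.2 (hle k y)) y
        · refine (indicator_le_self' (fun _ _ => sub_nonneg.2 (hle k y)) y).trans ?_
          rw [indicator_of_notMem hy, huoff y hy, hoff k y hy, sub_self]
    have h3 : (⨍ y in ball x ε, u y) - ⨍ y in ball x ε, U k y =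
        (volume.real (ball (0 : Space n) ε))⁻¹ * ∫ y in ball x ε, (u y - U k y) := by
      rw [integral_sub (integrable_of_abs_le hum huC) (integrable_of_abs_le (hb k).1 (hb k).2),
        setAverage_eq, setAverage_eq, Measure.addHaar_real_ball_center, smul_eq_mul, smul_eq_mul,
        mul_sub]
    have h4 := mul_le_mul_of_nonneg_left h2
      (inv_nonneg.2 (measureReal_nonneg (μ := volume) (s := ball (0 : Space n) ε)))
    rw [← h3] at h4
    change _ ≤ e k at h4
    linarith
  have hrec : ∀ k, s (k + 1) ≤ α * s k + β * e k := by
    intro k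
    have he : 0 ≤ e k := mul_nonneg (inv_nonneg.2 measureReal_nonneg)
      (integral_nonneg fun y => sub_nonneg.2 (hle k y))
    have hr : 0 ≤ α * s k + β * e k :=
      add_nonneg (mul_nonneg hα (hs0 k)) (mul_nonneg hβ.le he)
    refine ciSup_le fun x => ?_
    by_cases hx : x ∈ Ω
    · rw [sub_le_iff_le_add']
      -- It is not yet known that `u` solves the DPP, so `U (j + 1) x` is compared with `U (k + 1)
      -- x` and then `j` tends to infinity.
      refine le_of_tendsto' ((Filter.tendsto_add_atTop_iff_nat 1).2 (hlim x)) fun j => ?_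
      rw [hsuccΩ j x hx, hsuccΩ k x hx]
      have h1 := dppOp_le_add hα hβ.le hε (hb j).2 (hb k).2
        (fun y => (hle j y).trans (hs k y)) x (hav j k x)
      have h2 := mul_le_mul_of_nonneg_left h1 hl
      nlinarith
    · rw [huoff x hx, hoff _ x hx, sub_self]
      exact hr
  have hslim : Filter.Tendsto s Filter.atTop (nhds 0) := by
    have h1 := tendsto_atTop_ciInf hsanti ⟨0, by rintro _ ⟨k, rfl⟩; exact hs0 k⟩
    set σ := ⨅ k, s k
    have h2 : σ ≤ α * σ + β * 0 := le_of_tendsto_of_tendsto'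
      ((Filter.tendsto_add_atTop_iff_nat 1).2 h1) ((h1.const_mul α).add (he0.const_mul β)) hrec
    have h3 : 0 ≤ σ := ge_of_tendsto' h1 hs0
    -- From `σ ≤ α σ` and `1 - α = β > 0`.
    have h4 : σ = 0 := by nlinarith
    rwa [h4] at h1
  refine ⟨u, hum, huC, fun x hx => ?_, huoff⟩
  have hlim' : Filter.Tendsto (fun k => U (k + 1) x) Filter.atTop (nhds (u x)) :=
    (Filter.tendsto_add_atTop_iff_nat 1).2 (hlim x)
  -- One inequality uses `U k ≤ u`; the other uses `u ≤ U k + s k` with `s k` tending to zero.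
  refine le_antisymm (le_of_tendsto' hlim' fun k => ?_) (ge_of_tendsto' (hlim'.add hslim |>.trans
    (by simp)) fun k => ?_)
  · rw [hsuccΩ k x hx]
    have h0 := fun y => (hle k y).trans_eq (add_zero _).symm
    have := dppOp_le_add hα hβ.le hε (hb k).2 huC h0 x
      (setAverage_ball_le hε (hb k).1 hum (hb k).2 huC h0 x)
    exact mul_le_mul_of_nonneg_left (by linarith) hl
  · rw [hsuccΩ k x hx]
    have h1 := dppOp_le_add hα hβ.le hε huC (hb k).2 (hs k) x
      (setAverage_ball_le hε hum (hb k).1 huC (hb k).2 (hs k) x)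
    rw [← add_mul, hαβ, one_mul] at h1
    have h2 := mul_le_mul_of_nonneg_left h1 hl
    nlinarith [hs0 k]

end Existence

/-! ### Measurability and non-anticipation of the play -/

lemma measurable_toss (α : ℝ) : Measurable (toss α) :=
  Measurable.ite measurableSet_Iio measurable_const
    (Measurable.ite measurableSet_Iio measurable_const measurable_const)

lemma measurable_last : ∀ k, Measurable (History.last : History n k → Space n)
  | 0 => measurable_fst
  | k + 1 => by
    change Measurable fun h : History n (k + 1) => (h.2 (Fin.last k)).2
    fun_prop

lemma step_toss (α : ℝ) (SI SII : Strategy n) {k : ℕ} (h : History n k) (ξ : ℝ) (w : Space n) :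
    step SI SII h (toss α ξ) w =
      if ξ < α / 2 then SI.move k h else if ξ < α then SII.move k h else w := by
  unfold toss
  split_ifs <;> rfl

lemma measurable_step_toss (α : ℝ) (SI SII : Strategy n) (k : ℕ) :
    Measurable fun p : History n k × (ℝ × Space n) => step SI SII p.1 (toss α p.2.1) p.2.2 := by
  simp only [step_toss]
  have h1 := SI.measurable_move k
  have h2 := SII.measurable_move k
  exact Measurable.ite (measurableSet_lt (by fun_prop) (by fun_prop)) (by fun_prop)
    (Measurable.ite (measurableSet_lt (by fun_prop) (by fun_prop)) (by fun_prop) (by fun_prop))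

section Path

variable (α ε : ℝ) (SI SII : Strategy n) (x₀ : Space n)

lemma measurable_history (k : ℕ) : Measurable fun ω => history α ε SI SII x₀ ω k := by
  induction k with
  | zero => exact measurable_const
  | succ k ih =>
    have h1 : Measurable fun ω : Sample n => ω k := measurable_pi_apply k
    have h2 := (measurable_step_toss α SI SII k).comp (ih.prodMk h1)
    have h3 := (measurable_last k).comp ih
    have h4 := (measurable_toss α).comp (measurable_fst.comp h1)
    refine measurable_const.prodMk (measurable_pi_lambda _ fun i => ?_)
    refine Fin.lastCases ?_ (fun i => ?_) i
    · simp only [Fin.snoc_last]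
      exact h4.prodMk (h3.add (h2.const_smul ε))
    · simp only [Fin.snoc_castSucc]
      exact (measurable_pi_apply i).comp ih.snd

lemma measurable_position (k : ℕ) : Measurable fun ω => position α ε SI SII x₀ ω k :=
  (measurable_last k).comp (measurable_history α ε SI SII x₀ k)

/-- The first `k` rounds use only the inputs with indices below `k`; hence the history is
independent of `ω k`. -/
lemma history_congr {ω ω' : Sample n} (k : ℕ) (h : ∀ i < k, ω i = ω' i) :
    history α ε SI SII x₀ ω k = history α ε SI SII x₀ ω' k := by
  induction k with
  | zero => rfl
  | succ k ih =>
    have h1 := ih fun i hi => h i (hi.trans k.lt_succ_self)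
    simp only [history, h1, h k k.lt_succ_self]

lemma position_congr {ω ω' : Sample n} (k : ℕ) (h : ∀ i < k, ω i = ω' i) :
    position α ε SI SII x₀ ω k = position α ε SI SII x₀ ω' k := by
  rw [position, position, history_congr α ε SI SII x₀ k h]

lemma position_zero (ω : Sample n) : position α ε SI SII x₀ ω 0 = x₀ := rfl

lemma position_succ (ω : Sample n) (k : ℕ) :
    position α ε SI SII x₀ ω (k + 1) = position α ε SI SII x₀ ω k +
      ε • step SI SII (history α ε SI SII x₀ ω k) (toss α (ω k).1) (ω k).2 := by
  simp [position, history, History.last]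

end Path

/-! ### Expectation over a single round -/

instance : IsProbabilityMeasure (sampleLaw n) := by
  unfold sampleLaw; infer_instance

/-- Conditioning on the inputs of the first `k` rounds. -/
lemma integral_sampleLaw_eq_integral_integral {k : ℕ} {g : Sample n → ℝ × Space n → ℝ} {C : ℝ}
    (hg : Measurable (Function.uncurry g)) (hC : ∀ ω z, |g ω z| ≤ C)
    (hdep : ∀ ω ω', (∀ i < k, ω i = ω' i) → g ω = g ω') :
    ∫ ω, g ω (ω k) ∂(sampleLaw n) =
      ∫ ω, ∫ z, g ω z ∂(uniformInterval.prod (uniformBall n)) ∂(sampleLaw n) := by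
  classical
  set ν := uniformInterval.prod (uniformBall n)
  have hind : iIndepFun (fun i (ω : Sample n) => ω i) (sampleLaw n) :=
    iIndepFun_infinitePi (P := fun _ : ℕ => ν) (X := fun _ z => z) (fun _ => measurable_id)
  have hpair := hind.indepFun_finset (Finset.range k) {k} (by simp) fun i => measurable_pi_apply i
  have hev : Measurable fun f : ({k} : Finset ℕ) → ℝ × Space n =>
      f ⟨k, Finset.mem_singleton_self k⟩ := by fun_prop
  have hpair' := hpair.comp measurable_id hev
  have hlaw : (sampleLaw n).map (fun ω => ω k) = ν :=
    Measure.infinitePi_map_eval (fun _ : ℕ => ν) k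
  set r : Sample n → (Finset.range k → ℝ × Space n) := fun ω i => ω i
  have hr : Measurable r := by fun_prop
  -- Padding the first `k` inputs with zeros gives a full sample, so `g` factors through these
  -- inputs.
  let E : (Finset.range k → ℝ × Space n) → Sample n :=
    fun f i => if h : i ∈ Finset.range k then f ⟨i, h⟩ else 0
  have hE : Measurable E := measurable_pi_lambda _ fun i => by
    by_cases h : i ∈ Finset.range k
    · simp only [E, h, dite_true]; fun_prop
    · simp only [E, h, dite_false]; fun_prop
  have hEr : ∀ ω, g ω = g (E (r ω)) := fun ω => hdep _ _ fun i hi => by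
    simp [E, r, hi]
  have hmap : (sampleLaw n).map (fun ω => (r ω, ω k)) = ((sampleLaw n).map r).prod ν := by
    rw [← hlaw]
    exact (indepFun_iff_map_prod_eq_prod_map_map hr.aemeasurable
      (measurable_pi_apply k).aemeasurable).1 hpair'
  set G : (Finset.range k → ℝ × Space n) × (ℝ × Space n) → ℝ := fun p => g (E p.1) p.2
  have hG : Measurable G := hg.comp ((hE.comp measurable_fst).prodMk measurable_snd)
  have : IsProbabilityMeasure ((sampleLaw n).map r) := Measure.isProbabilityMeasure_map hr.aemeasurable
  calc ∫ ω, g ω (ω k) ∂(sampleLaw n) = ∫ ω, G (r ω, ω k) ∂(sampleLaw n) := by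
        refine integral_congr_ae (Filter.Eventually.of_forall fun ω => ?_)
        exact congrFun (hEr ω) _
    _ = ∫ p, G p ∂(((sampleLaw n).map r).prod ν) := by
        rw [← hmap, integral_map (hr.prodMk (measurable_pi_apply k)).aemeasurable
          hG.aestronglyMeasurable]
    _ = ∫ y, ∫ z, G (y, z) ∂ν ∂((sampleLaw n).map r) :=
        integral_prod _ (integrable_of_abs_le hG fun _ => hC _ _)
    _ = ∫ ω, ∫ z, G (r ω, z) ∂ν ∂(sampleLaw n) :=
        integral_map hr.aemeasurable hG.stronglyMeasurable.integral_prod_right.aestronglyMeasurable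
    _ = _ := by
        refine integral_congr_ae (Filter.Eventually.of_forall fun ω => ?_)
        simp only [G, hEr ω]

lemma uniformInterval_real_Iio {c : ℝ} (h1 : c ≤ 1) :
    uniformInterval.real (Iio c) = max c 0 := by
  rw [uniformInterval, measureReal_def, cond_apply measurableSet_Icc]
  have : Icc (0 : ℝ) 1 ∩ Iio c = Ico 0 c := by
    ext x; simp only [mem_inter_iff, mem_Icc, mem_Iio, mem_Ico]; grind
  rw [this]
  simp [ENNReal.toReal_ofReal']

/-- Averaging over the coin and the random vector in one round. -/
lemma integral_step {α ε C : ℝ} (hα : 0 ≤ α) (hα1 : α ≤ 1) (hε : 0 < ε) (SI SII : Strategy n)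
    {k : ℕ} (h : History n k) (x : Space n) {g : Space n → ℝ} (hg : Measurable g)
    (hC : ∀ x, |g x| ≤ C) :
    ∫ z, g (x + ε • step SI SII h (toss α z.1) z.2) ∂(uniformInterval.prod (uniformBall n)) =
      α / 2 * (g (x + ε • SI.move k h) + g (x + ε • SII.move k h)) +
        (1 - α) * ⨍ y in ball x ε, g y := by
  have hstep : Measurable fun z : ℝ × Space n => step SI SII h (toss α z.1) z.2 :=
    (measurable_step_toss α SI SII k).comp measurable_prodMk_left
  rw [integral_prod _ (integrable_of_abs_le (by fun_prop) fun _ => hC _), setAverage_ball_eq _ _ hε]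
  set a := g (x + ε • SI.move k h)
  set b := g (x + ε • SII.move k h)
  set m := ∫ w, g (x + ε • w) ∂(uniformBall n)
  -- As `α / 2 ≤ α`, the nested indicators telescope to the three values `a`, `b`, `m`.
  have h1 : ∀ ξ, ∫ w, g (x + ε • step SI SII h (toss α ξ) w) ∂(uniformBall n) =
      m + ((Iio (α / 2)).indicator (fun _ => a - b) ξ + (Iio α).indicator (fun _ => b - m) ξ) := by
    intro ξ
    simp only [step_toss]
    by_cases hξ : ξ < α / 2
    · have hξ' : ξ < α := by linarith
      simp [hξ, hξ', a]
    · by_cases hξ' : ξ < α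
      · simp [hξ, hξ', b]
      · simp [hξ, hξ', m]
  have hi (s : ℝ) (c : ℝ) : Integrable ((Iio s).indicator fun _ => c) uniformInterval :=
    (integrable_const c).indicator measurableSet_Iio
  simp only [h1]
  rw [integral_add (integrable_const _) (by exact (hi _ _).add (hi _ _)),
    integral_add (hi _ _) (hi _ _),
    integral_indicator_const _ measurableSet_Iio, integral_indicator_const _ measurableSet_Iio,
    uniformInterval_real_Iio (by linarith), uniformInterval_real_Iio hα1,
    max_eq_left hα, max_eq_left (by linarith)]
  simp only [integral_const, probReal_univ, smul_eq_mul]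
  ring

/-! ### Almost sure termination -/

/-- Almost surely, the inputs of `N` consecutive rounds lie in a given set of positive measure. -/
lemma ae_exists_run {S : Set (ℝ × Space n)} (hS : MeasurableSet S)
    (hpos : (uniformInterval.prod (uniformBall n)) S ≠ 0) (N : ℕ) :
    ∀ᵐ ω ∂(sampleLaw n), ∃ j, ∀ i < N, ω (j + i) ∈ S := by
  classical
  set ν := uniformInterval.prod (uniformBall n)
  -- Disjoint blocks of length `N` give independent events of the same positive probability; the
  -- second Borel–Cantelli lemma applies.
  set I : ℕ → Finset ℕ := fun j => Finset.Ico (j * N) (j * N + N)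
  set A : ℕ → Set (Sample n) := fun j => Set.pi (I j) fun _ => S
  have hdisj : Pairwise fun i j => Disjoint (I i) (I j) := by
    intro i j hij
    rw [Finset.disjoint_left]
    intro a hi hj
    rw [Finset.mem_Ico] at hi hj
    rcases lt_or_gt_of_ne hij with h | h
    · nlinarith [Nat.mul_le_mul_right N (Nat.succ_le_of_lt h)]
    · nlinarith [Nat.mul_le_mul_right N (Nat.succ_le_of_lt h)]
  have hbox (s : Finset ℕ) : sampleLaw n (Set.pi s fun _ => S) = ∏ _i ∈ s, ν S :=
    Measure.infinitePi_pi (μ := fun _ : ℕ => ν) fun _ _ => hS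
  have hA : ∀ j, MeasurableSet (A j) := fun j =>
    MeasurableSet.pi (Finset.countable_toSet _) fun _ _ => hS
  have hAm : ∀ j, sampleLaw n (A j) = ν S ^ N := fun j => by
    rw [hbox, Finset.prod_const, Nat.card_Ico, Nat.add_sub_cancel_left]
  have hind : iIndepSet A (sampleLaw n) := by
    rw [iIndepSet_iff_meas_biInter hA]
    intro s
    have : ⋂ j ∈ s, A j = Set.pi (s.biUnion I : Finset ℕ) fun _ => S := by
      ext ω
      simp only [A, mem_iInter, Set.mem_pi, Finset.mem_coe, Finset.mem_biUnion]
      grind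
    rw [this, hbox, Finset.prod_biUnion fun i _ j _ hij => hdisj hij]
    exact Finset.prod_congr rfl fun j _ => (hbox (I j)).symm
  have hsum : ∑' j, sampleLaw n (A j) = ⊤ := by
    simp only [hAm]
    exact ENNReal.tsum_const_eq_top_of_ne_zero (pow_ne_zero _ hpos)
  have h1 := measure_limsup_eq_one hA hind hsum
  have h2 : ∀ᵐ ω ∂(sampleLaw n), ω ∈ Filter.limsup A Filter.atTop :=
    (mem_ae_iff_prob_eq_one (MeasurableSet.measurableSet_limsup hA)).2 h1
  filter_upwards [h2] with ω hω
  rw [Filter.mem_limsup_iff_frequently_mem] at hω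
  obtain ⟨j, hj⟩ := hω.exists
  exact ⟨j * N, fun i hi => hj _ (by simp [I, hi])⟩

/-- A segment from `Ω` to its complement is connected, so it meets the frontier, at a point no
farther from `y` than `x` is. -/
lemma mem_extDomain_of_dist_lt {Ω : Set (Space n)} {ε : ℝ} {x y : Space n} (hx : x ∈ Ω)
    (hy : dist y x < ε) : y ∈ extDomain Ω ε := by
  by_cases hyΩ : y ∈ Ω
  · exact Or.inl hyΩ
  · refine Or.inr ⟨hyΩ, ?_⟩
    have hseg : (segment ℝ y x ∩ frontier Ω).Nonempty := by
      by_contra hem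
      have hnf : ∀ z ∈ segment ℝ y x, z ∉ frontier Ω := fun z hz hzf => hem ⟨z, hz, hzf⟩
      have hcov : segment ℝ y x ⊆ interior Ω ∪ (closure Ω)ᶜ := fun z hz => by
        by_cases hc : z ∈ closure Ω
        · exact Or.inl (by_contra fun hi => hnf z hz ⟨hc, hi⟩)
        · exact Or.inr hc
      have hxs := right_mem_segment ℝ y x
      have hys := left_mem_segment ℝ y x
      obtain ⟨z, -, hz1, hz2⟩ := (convex_segment y x).isPreconnected _ _ isOpen_interior
        isClosed_closure.isOpen_compl hcov
        ⟨x, hxs, (hcov hxs).resolve_right fun h => h (subset_closure hx)⟩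
        ⟨y, hys, (hcov hys).resolve_left fun h => hyΩ (interior_subset h)⟩
      exact hz2 (subset_closure (interior_subset hz1))
    obtain ⟨z, hz, hzf⟩ := hseg
    have hzb : z ∈ closedBall y (dist y x) := (convex_closedBall y (dist y x)).segment_subset
      (mem_closedBall_self dist_nonneg) (by rw [mem_closedBall, dist_comm]) hz
    rw [mem_closedBall, dist_comm] at hzb
    exact (infDist_le_dist_of_mem hzf).trans (hzb.trans hy.le)

lemma measurableSet_strip {Ω : Set (Space n)} (hΩ : IsOpen Ω) (ε : ℝ) :
    MeasurableSet (strip Ω ε) :=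
  hΩ.measurableSet.compl.inter
    (measurableSet_le (continuous_infDist_pt _).measurable measurable_const)

lemma uniformInterval_prod_uniformBall_ne_zero {α : ℝ} (hα : 0 ≤ α) (hα1 : α < 1) (i : Fin n) :
    (uniformInterval.prod (uniformBall n)) (Ici α ×ˢ {w : Space n | 1 / 2 < w i}) ≠ 0 := by
  rw [Measure.prod_prod, mul_ne_zero_iff]
  constructor
  · have h1 : Icc (0 : ℝ) 1 ∩ Ici α = Icc α 1 := by
      ext x; simp only [mem_inter_iff, mem_Icc, mem_Ici]; grind
    rw [uniformInterval, cond_apply measurableSet_Icc, h1]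
    simpa using hα1
  · have hopen : IsOpen {w : Space n | 1 / 2 < w i} := isOpen_lt (by fun_prop) (by fun_prop)
    have hne : (ball (0 : Space n) 1 ∩ {w | 1 / 2 < w i}).Nonempty := by
      refine ⟨EuclideanSpace.single i (3 / 4), ?_, ?_⟩
      · rw [mem_ball_zero_iff, PiLp.norm_single]
        norm_num
      · simp; norm_num
    rw [uniformBall, cond_apply measurableSet_ball]
    exact mul_ne_zero (ENNReal.inv_ne_zero.2 measure_ball_lt_top.ne)
      ((isOpen_ball.inter hopen).measure_pos _ hne).ne'

/-- Samples may contain arbitrary vectors, so the token is confined to the extended domain only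
almost surely. -/
lemma ae_mem_ball : ∀ᵐ ω ∂(sampleLaw n), ∀ k, (ω k).2 ∈ ball (0 : Space n) 1 := by
  rw [ae_all_iff]
  intro k
  have h1 : ∀ᵐ w ∂(uniformBall n), w ∈ ball (0 : Space n) 1 := by
    rw [uniformBall]
    exact ae_cond_mem measurableSet_ball
  have h2 : (sampleLaw n).map (fun ω => (ω k).2) = uniformBall n := by
    have h3 : (sampleLaw n).map (fun ω => ω k) = uniformInterval.prod (uniformBall n) :=
      Measure.infinitePi_map_eval (fun _ : ℕ => uniformInterval.prod (uniformBall n)) k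
    have h4 := Measure.map_map (μ := sampleLaw n) (g := Prod.snd) (f := fun ω => ω k)
      measurable_snd (measurable_pi_apply k)
    rw [h3, Measure.map_snd_prod, measure_univ, one_smul] at h4
    exact h4.symm
  rw [← h2] at h1
  exact ae_of_ae_map (measurable_snd.comp (measurable_pi_apply k)).aemeasurable h1

section Exit

variable {Ω : Set (Space n)} {α ε : ℝ} {SI SII : Strategy n} {x₀ : Space n} {ω : Sample n}

lemma norm_step_lt {k : ℕ} (h : History n k) (c : Toss) {w : Space n}
    (hw : w ∈ ball (0 : Space n) 1) : ‖step SI SII h c w‖ < 1 := by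
  rw [← mem_ball_zero_iff]
  cases c
  · exact SI.move_mem k h
  · exact SII.move_mem k h
  · exact hw

lemma position_succ_mem_extDomain (hε : 0 < ε) (hω : ∀ k, (ω k).2 ∈ ball (0 : Space n) 1) {k : ℕ}
    (hk : position α ε SI SII x₀ ω k ∈ Ω) :
    position α ε SI SII x₀ ω (k + 1) ∈ extDomain Ω ε := by
  refine mem_extDomain_of_dist_lt hk ?_
  rw [position_succ, dist_self_add_left, norm_smul, Real.norm_of_nonneg hε.le]
  exact mul_lt_of_lt_one_right hε (norm_step_lt _ _ (hω k))

lemma position_mem_of_forall_notMem_strip (hε : 0 < ε)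
    (hω : ∀ k, (ω k).2 ∈ ball (0 : Space n) 1) (hx₀ : x₀ ∈ extDomain Ω ε) (k : ℕ)
    (hk : ∀ j ≤ k, position α ε SI SII x₀ ω j ∉ strip Ω ε) :
    position α ε SI SII x₀ ω k ∈ Ω := by
  have hext : position α ε SI SII x₀ ω k ∈ extDomain Ω ε := by
    induction k with
    | zero => exact hx₀
    | succ k ih =>
      have hk' := fun j (hj : j ≤ k) => hk j (hj.trans k.le_succ)
      exact position_succ_mem_extDomain hε hω ((ih hk').resolve_right (hk' k le_rfl))
  exact hext.resolve_right (hk k le_rfl)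

/-- The game ends almost surely, whatever the strategies. -/
lemma ae_exists_position_mem_strip (hn : 0 < n) (hΩ : Bornology.IsBounded Ω) (hα : 0 ≤ α)
    (hα1 : α < 1) (hε : 0 < ε) (hx₀ : x₀ ∈ extDomain Ω ε) :
    ∀ᵐ ω ∂(sampleLaw n), ∃ k, position α ε SI SII x₀ ω k ∈ strip Ω ε := by
  obtain ⟨R, hR⟩ := hΩ.exists_norm_le
  -- Each move of the run raises one coordinate by more than `ε / 2`, whereas coordinates in `Ω`
  -- differ by at most `2 * R`.
  obtain ⟨N, hN⟩ := exists_nat_gt (2 * R / (ε / 2))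
  let i : Fin n := ⟨0, hn⟩
  have hS : MeasurableSet (Ici α ×ˢ {w : Space n | 1 / 2 < w i}) :=
    measurableSet_Ici.prod (measurableSet_lt (by fun_prop) (by fun_prop))
  filter_upwards [ae_mem_ball, ae_exists_run hS
    (uniformInterval_prod_uniformBall_ne_zero hα hα1 i) N] with ω hω ⟨j, hj⟩
  by_contra! hnot
  have hin : ∀ k, position α ε SI SII x₀ ω k ∈ Ω := fun k =>
    position_mem_of_forall_notMem_strip hε hω hx₀ k fun j _ => hnot j
  have hrun : ∀ m ≤ N, position α ε SI SII x₀ ω j i + m * (ε / 2) ≤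
      position α ε SI SII x₀ ω (j + m) i := by
    intro m
    induction m with
    | zero => simp
    | succ m ih =>
      intro hm
      obtain ⟨h1, h2⟩ := hj m hm
      have h1' : α ≤ (ω (j + m)).1 := h1
      have h2' : 1 / 2 < (ω (j + m)).2 i := h2
      have h3 := ih (by omega)
      rw [← add_assoc, position_succ, step_toss, if_neg (by linarith), if_neg (by linarith)]
      have h4 := mul_lt_mul_of_pos_left h2' hε
      push_cast
      simp only [PiLp.add_apply, PiLp.smul_apply, smul_eq_mul]
      linarith
  have h1 := hrun N le_rfl
  have h2 (k : ℕ) : |position α ε SI SII x₀ ω k i| ≤ R :=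
    (PiLp.norm_apply_le (position α ε SI SII x₀ ω k) i).trans (hR _ (hin k))
  have h3 := abs_le.1 (h2 j)
  have h4 := abs_le.1 (h2 (j + N))
  rw [div_lt_iff₀ (by positivity)] at hN
  linarith

end Exit

/-! ### Bounds and sign symmetry of the payoff -/

section Payoff

variable {Ω : Set (Space n)} {F : Space n → ℝ} {α β γ ε C : ℝ} {x₀ : Space n}

lemma payoff_neg (SI SII : Strategy n) (ω : Sample n) :
    payoff Ω (fun x => -F x) α γ ε SI SII x₀ ω = -payoff Ω F α γ ε SI SII x₀ ω := by
  unfold payoff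
  split_ifs <;> simp

lemma expectedPayoff_neg (SI SII : Strategy n) :
    expectedPayoff Ω (fun x => -F x) α γ ε SI SII x₀ = -expectedPayoff Ω F α γ ε SI SII x₀ := by
  simp only [expectedPayoff, payoff_neg, integral_neg]

lemma abs_payoff_le (hC : 0 ≤ C) (hF : ∀ x ∈ strip Ω ε, |F x| ≤ C) (hl : 0 ≤ 1 - γ * ε ^ 2)
    (hl1 : 1 - γ * ε ^ 2 ≤ 1) (SI SII : Strategy n) (ω : Sample n) :
    |payoff Ω F α γ ε SI SII x₀ ω| ≤ C := by
  classical
  unfold payoff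
  split_ifs with h
  · rw [abs_mul, abs_of_nonneg (pow_nonneg hl _)]
    exact (mul_le_of_le_one_left (abs_nonneg _) (pow_le_one₀ hl hl1)).trans
      (hF _ (Nat.find_spec h))
  · simpa using hC

lemma abs_expectedPayoff_le (hC : 0 ≤ C) (hF : ∀ x ∈ strip Ω ε, |F x| ≤ C)
    (hl : 0 ≤ 1 - γ * ε ^ 2) (hl1 : 1 - γ * ε ^ 2 ≤ 1) (SI SII : Strategy n) :
    |expectedPayoff Ω F α γ ε SI SII x₀| ≤ C := by
  have := norm_integral_le_of_norm_le_const (μ := sampleLaw n)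
    (f := payoff Ω F α γ ε SI SII x₀)
    (Filter.Eventually.of_forall fun ω => abs_payoff_le hC hF hl hl1 SI SII ω)
  simpa [expectedPayoff] using this

end Payoff

/-! ### The stopped discounted process -/

/-- The increment in one round of the discounted process `l ^ k * v X_k` stopped on leaving `Ω`,
as a function of the inputs of the earlier rounds and of the input `z` of this round. -/
noncomputable def increment (Ω : Set (Space n)) (v : Space n → ℝ) (α ε l : ℝ) (SI SII : Strategy n)
    (x₀ : Space n) (k : ℕ) (ω : Sample n) (z : ℝ × Space n) : ℝ :=
  {ω | ∀ j ≤ k, position α ε SI SII x₀ ω j ∈ Ω}.indicator (fun ω => l ^ k *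
    (l * v (position α ε SI SII x₀ ω k +
      ε • step SI SII (history α ε SI SII x₀ ω k) (toss α z.1) z.2) -
        v (position α ε SI SII x₀ ω k))) ω

section Increment

variable {Ω : Set (Space n)} {v : Space n → ℝ} {α β ε l C : ℝ} {SI SII : Strategy n} {x₀ : Space n}

lemma increment_eq_zero {k j : ℕ} (hjk : j ≤ k) {ω : Sample n} (z : ℝ × Space n)
    (hω : position α ε SI SII x₀ ω j ∉ Ω) : increment Ω v α ε l SI SII x₀ k ω z = 0 :=
  indicator_of_notMem (fun h : ∀ j ≤ k, position α ε SI SII x₀ ω j ∈ Ω => hω (h j hjk)) _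

lemma increment_self {k : ℕ} {ω : Sample n} (hω : ∀ j ≤ k, position α ε SI SII x₀ ω j ∈ Ω) :
    increment Ω v α ε l SI SII x₀ k ω (ω k) =
      l ^ (k + 1) * v (position α ε SI SII x₀ ω (k + 1)) -
        l ^ k * v (position α ε SI SII x₀ ω k) := by
  rw [increment, indicator_of_mem (by exact hω), position_succ]
  ring

lemma measurable_increment (hΩ : MeasurableSet Ω) (hv : Measurable v) (k : ℕ) :
    Measurable (Function.uncurry (increment Ω v α ε l SI SII x₀ k)) := by
  have hX := measurable_position α ε SI SII x₀
  have hH := measurable_history α ε SI SII x₀ k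
  have hst : Measurable fun p : Sample n × (ℝ × Space n) =>
      step SI SII (history α ε SI SII x₀ p.1 k) (toss α p.2.1) p.2.2 :=
    (measurable_step_toss α SI SII k).comp ((hH.comp measurable_fst).prodMk measurable_snd)
  have hXk : Measurable fun p : Sample n × (ℝ × Space n) => position α ε SI SII x₀ p.1 k :=
    (hX k).comp measurable_fst
  have hA : MeasurableSet {ω : Sample n | ∀ j ≤ k, position α ε SI SII x₀ ω j ∈ Ω} := by
    have : {ω : Sample n | ∀ j ≤ k, position α ε SI SII x₀ ω j ∈ Ω} =
        ⋂ j ∈ Iic k, (fun ω => position α ε SI SII x₀ ω j) ⁻¹' Ω := by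
      ext; simp
    rw [this]
    exact MeasurableSet.biInter (to_countable _) fun j _ => hX j hΩ
  have hm : Measurable fun p : Sample n × (ℝ × Space n) => l ^ k *
      (l * v (position α ε SI SII x₀ p.1 k +
        ε • step SI SII (history α ε SI SII x₀ p.1 k) (toss α p.2.1) p.2.2) -
          v (position α ε SI SII x₀ p.1 k)) := by fun_prop
  exact hm.indicator (measurable_fst hA)

lemma abs_increment_le (hl : 0 ≤ l) (hl1 : l ≤ 1) (hv : ∀ x, |v x| ≤ C) (k : ℕ) (ω : Sample n)
    (z : ℝ × Space n) : |increment Ω v α ε l SI SII x₀ k ω z| ≤ 2 * C := by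
  have hC : 0 ≤ C := (abs_nonneg _).trans (hv 0)
  by_cases hω : ω ∈ {ω | ∀ j ≤ k, position α ε SI SII x₀ ω j ∈ Ω}
  · rw [increment, indicator_of_mem hω, abs_mul, abs_of_nonneg (pow_nonneg hl _)]
    refine (mul_le_of_le_one_left (abs_nonneg _) (pow_le_one₀ hl hl1)).trans
      ((abs_sub _ _).trans ?_)
    rw [abs_mul, abs_of_nonneg hl]
    have := (mul_le_of_le_one_left (abs_nonneg _) hl1).trans (hv (position α ε SI SII x₀ ω k +
      ε • step SI SII (history α ε SI SII x₀ ω k) (toss α z.1) z.2))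
    linarith [hv (position α ε SI SII x₀ ω k)]
  · rw [increment, indicator_of_notMem hω, abs_zero]
    positivity

lemma increment_congr (k : ℕ) {ω ω' : Sample n} (h : ∀ i < k, ω i = ω' i) :
    increment Ω v α ε l SI SII x₀ k ω = increment Ω v α ε l SI SII x₀ k ω' := by
  funext z
  have hpos : ∀ j ≤ k, position α ε SI SII x₀ ω j = position α ε SI SII x₀ ω' j := fun j hj =>
    position_congr α ε SI SII x₀ j fun i hi => h i (hi.trans_le hj)
  have hmem : ω ∈ {ω | ∀ j ≤ k, position α ε SI SII x₀ ω j ∈ Ω} ↔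
      ω' ∈ {ω | ∀ j ≤ k, position α ε SI SII x₀ ω j ∈ Ω} := by
    simp only [mem_ofPred_eq]
    exact forall₂_congr fun j hj => by rw [hpos j hj]
  unfold increment
  by_cases hω : ω ∈ {ω | ∀ j ≤ k, position α ε SI SII x₀ ω j ∈ Ω}
  · rw [indicator_of_mem hω, indicator_of_mem (hmem.1 hω), hpos k le_rfl,
      history_congr α ε SI SII x₀ k h]
  · rw [indicator_of_notMem hω, indicator_of_notMem (mt hmem.2 hω)]

/-- The expected increment in a round is at most the error `η` with which `v` satisfies the one-step
supermartingale inequality along the given strategies. -/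
lemma integral_increment_le {η : ℝ} (hΩ : MeasurableSet Ω) (hα : 0 ≤ α) (hα1 : α ≤ 1)
    (hαβ : α + β = 1) (hε : 0 < ε) (hl : 0 ≤ l) (hl1 : l ≤ 1) (hvm : Measurable v)
    (hv : ∀ x, |v x| ≤ C) (hη : 0 ≤ η) (k : ℕ)
    (hstep : ∀ h : History n k, h.last ∈ Ω →
      l * (α / 2 * (v (h.last + ε • SI.move k h) + v (h.last + ε • SII.move k h)) +
        β * ⨍ y in ball h.last ε, v y) ≤ v h.last + η) :
    ∫ ω, increment Ω v α ε l SI SII x₀ k ω (ω k) ∂(sampleLaw n) ≤ η := by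
  have hm := measurable_increment (α := α) (ε := ε) (l := l) (SI := SI) (SII := SII)
    (x₀ := x₀) hΩ hvm k
  have hb := abs_increment_le (Ω := Ω) (α := α) (ε := ε) (SI := SI) (SII := SII) (x₀ := x₀)
    hl hl1 hv k
  rw [integral_sampleLaw_eq_integral_integral hm hb fun _ _ => increment_congr k]
  have hint : Integrable (Function.uncurry (increment Ω v α ε l SI SII x₀ k))
      ((sampleLaw n).prod (uniformInterval.prod (uniformBall n))) :=
    integrable_of_abs_le hm fun p => hb p.1 p.2
  calc _ ≤ ∫ _ : Sample n, η ∂(sampleLaw n) :=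
        integral_mono hint.integral_prod_left (integrable_const η) fun ω => ?_
    _ = η := by simp
  by_cases hω : ω ∈ {ω | ∀ j ≤ k, position α ε SI SII x₀ ω j ∈ Ω}
  · set H := history α ε SI SII x₀ ω k with hH
    have hX : position α ε SI SII x₀ ω k = H.last := rfl
    have hst : Measurable fun z : ℝ × Space n => step SI SII H (toss α z.1) z.2 :=
      (measurable_step_toss α SI SII k).comp measurable_prodMk_left
    have hiv : Integrable (fun z : ℝ × Space n => l * v (H.last + ε •
        step SI SII H (toss α z.1) z.2)) (uniformInterval.prod (uniformBall n)) :=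
      (integrable_of_abs_le (by fun_prop) fun _ => hv _).const_mul l
    simp only [Function.uncurry, increment, indicator_of_mem hω, hX, ← hH]
    rw [integral_const_mul, integral_sub hiv (integrable_const _), integral_const_mul,
      integral_step hα hα1 hε SI SII H H.last hvm hv, ← eq_sub_of_add_eq' hαβ]
    simp only [integral_const, probReal_univ, one_smul]
    have h1 := hstep H (hω k le_rfl)
    -- Discounting only shrinks the one-step error.
    calc _ ≤ l ^ k * η := mul_le_mul_of_nonneg_left (by linarith) (pow_nonneg hl k)
      _ ≤ η := mul_le_of_le_one_left hη (pow_le_one₀ hl hl1)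
  · simpa only [Function.uncurry, increment, indicator_of_notMem hω, integral_zero] using hη

lemma stopped_eq_of_forall_mem {ω : Sample n} (K : ℕ)
    (hω : ∀ j < K, position α ε SI SII x₀ ω j ∈ Ω) :
    v x₀ + ∑ k ∈ Finset.range K, increment Ω v α ε l SI SII x₀ k ω (ω k) =
      l ^ K * v (position α ε SI SII x₀ ω K) := by
  induction K with
  | zero => simp [position_zero]
  | succ K ih =>
    rw [Finset.sum_range_succ, ← add_assoc, ih fun j hj => hω j (hj.trans K.lt_succ_self),
      increment_self fun j hj => hω j (Nat.lt_succ_of_le hj)]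
    ring

/-- Up to the first exit the sum telescopes to a discounted value of `v`; afterwards the increments
vanish and the process is frozen. -/
lemma abs_stopped_le (hl : 0 ≤ l) (hl1 : l ≤ 1) (hv : ∀ x, |v x| ≤ C) (ω : Sample n) (K : ℕ) :
    |v x₀ + ∑ k ∈ Finset.range K, increment Ω v α ε l SI SII x₀ k ω (ω k)| ≤ C := by
  induction K with
  | zero => simpa using hv x₀
  | succ K ih =>
    by_cases hω : ∀ j < K + 1, position α ε SI SII x₀ ω j ∈ Ω
    · rw [stopped_eq_of_forall_mem _ hω, abs_mul, abs_of_nonneg (pow_nonneg hl _)]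
      exact (mul_le_of_le_one_left (abs_nonneg _) (pow_le_one₀ hl hl1)).trans (hv _)
    · push Not at hω
      obtain ⟨j, hj, hjΩ⟩ := hω
      rwa [Finset.sum_range_succ, increment_eq_zero (Nat.le_of_lt_succ hj) _ hjΩ, add_zero]

/-- If `v` almost satisfies the one-step supermartingale inequality along the given strategies,
then the expected payoff is at most the initial value of `v`, up to the sum of the errors. -/
theorem expectedPayoff_le {F : Space n → ℝ} {γ E : ℝ} {η : ℕ → ℝ} (hn : 0 < n) (hΩ : MeasurableSet Ω)
    (hΩb : Bornology.IsBounded Ω) (hα : 0 ≤ α) (hα1 : α < 1) (hαβ : α + β = 1) (hε : 0 < ε)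
    (hl : 0 ≤ 1 - γ * ε ^ 2) (hl1 : 1 - γ * ε ^ 2 ≤ 1) (hvm : Measurable v) (hv : ∀ x, |v x| ≤ C)
    (hvF : ∀ x ∈ strip Ω ε, v x = F x) (hη : ∀ k, 0 ≤ η k)
    (hE : ∀ K, ∑ k ∈ Finset.range K, η k ≤ E)
    (hstep : ∀ k, ∀ h : History n k, h.last ∈ Ω →
      (1 - γ * ε ^ 2) *
        (α / 2 * (v (h.last + ε • SI.move k h) + v (h.last + ε • SII.move k h)) +
          β * ⨍ y in ball h.last ε, v y) ≤ v h.last + η k)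
    (hx₀ : x₀ ∈ extDomain Ω ε) :
    expectedPayoff Ω F α γ ε SI SII x₀ ≤ v x₀ + E := by
  classical
  set l := 1 - γ * ε ^ 2 with hldef
  have hmi : ∀ k, Measurable fun ω : Sample n => increment Ω v α ε l SI SII x₀ k ω (ω k) :=
    fun k => (measurable_increment hΩ hvm k).comp (measurable_id.prodMk (measurable_pi_apply k))
  set Y : ℕ → Sample n → ℝ := fun K ω =>
    v x₀ + ∑ k ∈ Finset.range K, increment Ω v α ε l SI SII x₀ k ω (ω k)
  have hYm : ∀ K, Measurable (Y K) := fun K => by fun_prop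
  have hlim : Filter.Tendsto (fun K => ∫ ω, Y K ω ∂(sampleLaw n)) Filter.atTop
      (nhds (expectedPayoff Ω F α γ ε SI SII x₀)) := by
    refine tendsto_integral_of_dominated_convergence (fun _ => C)
      (fun K => (hYm K).aestronglyMeasurable) (integrable_const _)
      (fun K => Filter.Eventually.of_forall fun ω => abs_stopped_le hl hl1 hv ω K) ?_
    filter_upwards [ae_mem_ball, ae_exists_position_mem_strip (SI := SI) (SII := SII) hn hΩb hα hα1
      hε hx₀] with ω hω hex
    have hT := Nat.find_spec hex
    have hbefore : ∀ j < Nat.find hex, position α ε SI SII x₀ ω j ∈ Ω := fun j hj =>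
      position_mem_of_forall_notMem_strip hε hω hx₀ j fun i hi => Nat.find_min hex (hi.trans_lt hj)
    -- Once the strip is reached, the process stays equal to the payoff.
    refine tendsto_atTop_of_eventually_const (i₀ := Nat.find hex) fun K hK => ?_
    have hYK : Y K ω = Y (Nat.find hex) ω := by
      refine congrArg (v x₀ + ·) ?_
      refine (Finset.sum_subset (Finset.range_mono hK) fun k _ hk => ?_).symm
      rw [Finset.mem_range, not_lt] at hk
      exact increment_eq_zero hk _ hT.1
    rw [hYK, payoff, dif_pos hex, ← hldef, ← hvF _ hT]
    exact stopped_eq_of_forall_mem _ hbefore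
  refine le_of_tendsto' hlim fun K => ?_
  have hi : ∀ k, Integrable (fun ω : Sample n => increment Ω v α ε l SI SII x₀ k ω (ω k))
      (sampleLaw n) := fun k => integrable_of_abs_le (hmi k) fun ω => abs_increment_le hl hl1 hv k _ _
  rw [integral_add (integrable_const _) (integrable_finsetSum _ fun k _ => hi k),
    integral_finsetSum _ fun k _ => hi k]
  simp only [integral_const, probReal_univ, one_smul]
  gcongr
  refine (Finset.sum_le_sum fun k _ => ?_).trans (hE K)
  exact integral_increment_le hΩ hα hα1.le hαβ hε hl hl1 hvm hv (hη k) k (hstep k)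

end Increment

/-! ### Nearly optimal strategies and the value -/

instance : Nonempty (Strategy n) :=
  ⟨⟨fun _ _ => 0, fun _ => measurable_const, fun _ _ => mem_ball_self one_pos⟩⟩

/-- The move depends on the history only through the last position and the round number, the latter
so that the errors can be made summable. -/
lemma exists_strategy_near_sSup {v : Space n → ℝ} {C ε : ℝ} (hε : 0 < ε) (hv : ∀ x, |v x| ≤ C)
    {η : ℕ → ℝ} (hη : ∀ k, 0 < η k) :
    ∃ S : Strategy n, ∀ k, ∀ h : History n k,
      sSup (v '' ball h.last ε) - η k ≤ v (h.last + ε • S.move k h) := by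
  choose f hfm hfb hf using fun k => exists_measurable_near_sSup hε (hη k) hv
  exact ⟨⟨fun k h => f k h.last, fun k => (hfm k).comp (measurable_last k), fun k h => hfb k _⟩,
    fun k h => hf k _⟩

section Value

variable {Ω : Set (Space n)} {F v : Space n → ℝ} {α β γ ε C δ : ℝ}

lemma add_smul_mem_ball {ε : ℝ} (hε : 0 < ε) (x : Space n) {w : Space n}
    (hw : w ∈ ball (0 : Space n) 1) : x + ε • w ∈ ball x ε := by
  rw [mem_ball, dist_self_add_left, norm_smul, Real.norm_of_nonneg hε.le]
  exact mul_lt_of_lt_one_right hε (mem_ball_zero_iff.1 hw)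

lemma sum_half_pow_le (hδ : 0 ≤ δ) (K : ℕ) :
    ∑ k ∈ Finset.range K, δ / 2 * (1 / 2) ^ k ≤ δ := by
  rw [← Finset.mul_sum]
  have := mul_le_mul_of_nonneg_left (sum_geometric_two_le K) (div_nonneg hδ zero_le_two)
  linarith

/-- Player II can keep the expected payoff below any bounded Borel solution, up to `δ`. -/
lemma exists_strategyII (hn : 0 < n) (hΩ : MeasurableSet Ω) (hΩb : Bornology.IsBounded Ω)
    (hα : 0 ≤ α) (hα1 : α < 1) (hαβ : α + β = 1) (hε : 0 < ε) (hl : 0 ≤ 1 - γ * ε ^ 2)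
    (hl1 : 1 - γ * ε ^ 2 ≤ 1) (hvm : Measurable v) (hv : ∀ x, |v x| ≤ C)
    (hvF : ∀ x ∈ strip Ω ε, v x = F x)
    (hdpp : ∀ x ∈ Ω, v x = (1 - γ * ε ^ 2) * dppOp α β ε v x) (hδ : 0 < δ) :
    ∃ SII : Strategy n, ∀ SI : Strategy n, ∀ x₀ ∈ extDomain Ω ε,
      expectedPayoff Ω F α γ ε SI SII x₀ ≤ v x₀ + δ := by
  have hη : ∀ k : ℕ, 0 < δ / 2 * (1 / 2) ^ k := fun k => by positivity
  -- Nearly maximizing `-v` means nearly minimizing `v`.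
  obtain ⟨SII, hS⟩ := exists_strategy_near_sSup (v := fun x => -v x) hε
    (fun x => by simpa using hv x) hη
  refine ⟨SII, fun SI x₀ hx₀ => ?_⟩
  refine expectedPayoff_le hn hΩ hΩb hα hα1 hαβ hε hl hl1 hvm hv hvF (fun k => (hη k).le)
    (sum_half_pow_le hδ.le) (fun k h hh => ?_) hx₀
  have h1 := hS k h
  rw [sSup_neg_image] at h1
  have h2 := le_csSup (bddAbove_image_of_abs_le hv _)
    (mem_image_of_mem v (add_smul_mem_ball hε h.last (SI.move_mem k h)))
  have h3 := hdpp _ hh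
  set η := δ / 2 * (1 / 2) ^ k
  have hη0 : 0 < η := hη k
  set l := 1 - γ * ε ^ 2
  rw [dppOp] at h3
  have h4 : α / 2 * (v (h.last + ε • SI.move k h) + v (h.last + ε • SII.move k h)) ≤
      α / 2 * (sSup (v '' ball h.last ε) + sInf (v '' ball h.last ε) + η) :=
    mul_le_mul_of_nonneg_left (by linarith) (by positivity)
  have h5 : α / 2 * η ≤ η := mul_le_of_le_one_left hη0.le (by linarith)
  have h6 : l * η ≤ η := mul_le_of_le_one_left hη0.le hl1
  have h7 := mul_le_mul_of_nonneg_left (h4.trans (by linarith :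
    _ ≤ α / 2 * (sSup (v '' ball h.last ε) + sInf (v '' ball h.last ε)) + η)) hl
  linarith

/-- Player I can keep the expected payoff above any bounded Borel solution, up to `δ`. -/
lemma exists_strategyI (hn : 0 < n) (hΩ : MeasurableSet Ω) (hΩb : Bornology.IsBounded Ω)
    (hα : 0 ≤ α) (hα1 : α < 1) (hαβ : α + β = 1) (hε : 0 < ε) (hl : 0 ≤ 1 - γ * ε ^ 2)
    (hl1 : 1 - γ * ε ^ 2 ≤ 1) (hvm : Measurable v) (hv : ∀ x, |v x| ≤ C)
    (hvF : ∀ x ∈ strip Ω ε, v x = F x)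
    (hdpp : ∀ x ∈ Ω, v x = (1 - γ * ε ^ 2) * dppOp α β ε v x) (hδ : 0 < δ) :
    ∃ SI : Strategy n, ∀ SII : Strategy n, ∀ x₀ ∈ extDomain Ω ε,
      v x₀ - δ ≤ expectedPayoff Ω F α γ ε SI SII x₀ := by
  have hη : ∀ k : ℕ, 0 < δ / 2 * (1 / 2) ^ k := fun k => by positivity
  obtain ⟨SI, hS⟩ := exists_strategy_near_sSup hε hv hη
  refine ⟨SI, fun SII x₀ hx₀ => ?_⟩
  -- Changing the signs of `v` and `F` turns the lower bound into an instance of the upper bound.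
  suffices h : expectedPayoff Ω (fun x => -F x) α γ ε SI SII x₀ ≤ -v x₀ + δ by
    rw [expectedPayoff_neg] at h
    linarith
  refine expectedPayoff_le (v := fun x => -v x) (C := C) hn hΩ hΩb hα hα1 hαβ hε hl hl1 hvm.neg
    (fun x => by simpa using hv x) (fun x hx => by rw [hvF x hx]) (fun k => (hη k).le)
    (sum_half_pow_le hδ.le) (fun k h hh => ?_) hx₀
  have h1 := hS k h
  have h2 := csInf_le (bddBelow_image_of_abs_le hv _)
    (mem_image_of_mem v (add_smul_mem_ball hε h.last (SII.move_mem k h)))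
  have h3 := hdpp _ hh
  set η := δ / 2 * (1 / 2) ^ k
  have hη0 : 0 < η := hη k
  set l := 1 - γ * ε ^ 2
  rw [dppOp] at h3
  rw [average_neg]
  have h4 : α / 2 * (sSup (v '' ball h.last ε) + sInf (v '' ball h.last ε) - η) ≤
      α / 2 * (v (h.last + ε • SI.move k h) + v (h.last + ε • SII.move k h)) :=
    mul_le_mul_of_nonneg_left (by linarith) (by positivity)
  have h5 : α / 2 * η ≤ η := mul_le_of_le_one_left hη0.le (by linarith)
  have h6 : l * η ≤ η := mul_le_of_le_one_left hη0.le hl1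
  have h7 := mul_le_mul_of_nonneg_left ((by linarith :
    α / 2 * (sSup (v '' ball h.last ε) + sInf (v '' ball h.last ε)) - η ≤ _).trans h4) hl
  linarith

/-- A bounded Borel solution of the dynamic programming principle is the value of the game. -/
theorem value_eq {C' : ℝ} (hn : 0 < n) (hΩ : MeasurableSet Ω) (hΩb : Bornology.IsBounded Ω)
    (hα : 0 ≤ α) (hα1 : α < 1) (hαβ : α + β = 1) (hε : 0 < ε) (hl : 0 ≤ 1 - γ * ε ^ 2)
    (hl1 : 1 - γ * ε ^ 2 ≤ 1) (hC' : 0 ≤ C') (hF : ∀ x ∈ strip Ω ε, |F x| ≤ C')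
    (hvm : Measurable v) (hv : ∀ x, |v x| ≤ C) (hvF : ∀ x ∈ strip Ω ε, v x = F x)
    (hdpp : ∀ x ∈ Ω, v x = (1 - γ * ε ^ 2) * dppOp α β ε v x) {x₀ : Space n}
    (hx₀ : x₀ ∈ extDomain Ω ε) :
    v x₀ = valueI Ω F α γ ε x₀ ∧ v x₀ = valueII Ω F α γ ε x₀ := by
  have hb := fun SI SII : Strategy n =>
    abs_le.1 (abs_expectedPayoff_le (x₀ := x₀) (α := α) hC' hF hl hl1 SI SII)
  have hbelow : ∀ SI, BddBelow (range fun SII => expectedPayoff Ω F α γ ε SI SII x₀) := fun SI =>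
    ⟨-C', by rintro _ ⟨SII, rfl⟩; exact (hb SI SII).1⟩
  have habove : ∀ SII, BddAbove (range fun SI => expectedPayoff Ω F α γ ε SI SII x₀) := fun SII =>
    ⟨C', by rintro _ ⟨SI, rfl⟩; exact (hb SI SII).2⟩
  obtain ⟨S₀⟩ : Nonempty (Strategy n) := inferInstance
  have hI_above : BddAbove (range fun SI => ⨅ SII, expectedPayoff Ω F α γ ε SI SII x₀) :=
    ⟨C', by rintro _ ⟨SI, rfl⟩; exact (ciInf_le (hbelow SI) S₀).trans (hb SI S₀).2⟩
  have hII_below : BddBelow (range fun SII => ⨆ SI, expectedPayoff Ω F α γ ε SI SII x₀) :=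
    ⟨-C', by rintro _ ⟨SII, rfl⟩; exact (hb S₀ SII).1.trans (le_ciSup (habove SII) S₀)⟩
  -- The chain `v x₀ ≤ valueI ≤ valueII ≤ v x₀` closes up.
  have h1 : v x₀ ≤ valueI Ω F α γ ε x₀ := by
    refine le_of_forall_pos_le_add fun δ hδ => ?_
    obtain ⟨SI, hSI⟩ := exists_strategyI hn hΩ hΩb hα hα1 hαβ hε hl hl1 hvm hv hvF hdpp hδ
    have := (le_ciInf fun SII => hSI SII x₀ hx₀).trans (le_ciSup hI_above SI)
    exact sub_le_iff_le_add.1 this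
  have h2 : valueI Ω F α γ ε x₀ ≤ valueII Ω F α γ ε x₀ :=
    ciSup_le fun SI => le_ciInf fun SII =>
      (ciInf_le (hbelow SI) SII).trans (le_ciSup (habove SII) SI)
  have h3 : valueII Ω F α γ ε x₀ ≤ v x₀ := by
    refine le_of_forall_pos_le_add fun δ hδ => ?_
    obtain ⟨SII, hSII⟩ := exists_strategyII hn hΩ hΩb hα hα1 hαβ hε hl hl1 hvm hv hvF hdpp hδ
    exact (ciInf_le hII_below SII).trans (ciSup_le fun SI => hSII SI x₀ hx₀)
  exact ⟨h1.antisymm (h2.trans h3), (h1.trans h2).antisymm h3⟩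

end Value

/-! ### Passage from the extended domain to the whole space -/

lemma measurable_indicator_of_measurable_restrict {X : Type*} [MeasurableSpace X] {s : Set X}
    (hs : MeasurableSet s) {f : X → ℝ} (hf : Measurable fun x : s => f x) :
    Measurable (s.indicator f) := by
  refine measurable_of_restrict_of_restrict_compl hs ?_ ?_
  · convert hf using 1
    exact funext fun x => indicator_of_mem x.2 f
  · convert measurable_const (a := (0 : ℝ)) using 1
    exact funext fun x => indicator_of_notMem x.2 f

lemma abs_indicator_le {X : Type*} {s : Set X} {f : X → ℝ} {C : ℝ} (hC : 0 ≤ C)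
    (hf : ∀ x ∈ s, |f x| ≤ C) (x : X) : |s.indicator f x| ≤ C := by
  by_cases hx : x ∈ s
  · rw [indicator_of_mem hx]
    exact hf x hx
  · rw [indicator_of_notMem hx, abs_zero]
    exact hC

lemma dppOp_congr {α β ε : ℝ} {u v : Space n → ℝ} {x : Space n}
    (h : ∀ y ∈ ball x ε, u y = v y) : dppOp α β ε u x = dppOp α β ε v x := by
  rw [dppOp, dppOp, image_congr h, setAverage_congr_fun measurableSet_ball
    (Filter.Eventually.of_forall h)]

end TugOfWar

open TugOfWar in
theorem mainTheorem4 {n : ℕ} (hn : 0 < n)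
    (Ω : Set (TugOfWar.Space n)) (hΩ_open : IsOpen Ω) (hΩ_conn : IsConnected Ω)
    (hΩ_bdd : Bornology.IsBounded Ω)
    (α β γ ε : ℝ) (hα : 0 < α) (hβ : 0 < β) (hαβ : α + β = 1) (hγ : 0 ≤ γ) (hε : 0 < ε)
    (hγε : γ * ε ^ 2 < 1 / 2)
    (F : TugOfWar.Space n → ℝ)
    (hF_meas : Measurable (fun x : TugOfWar.strip Ω ε => F x))
    (hF_bdd : ∃ C : ℝ, ∀ x ∈ TugOfWar.strip Ω ε, |F x| ≤ C) :
    ∃ u : TugOfWar.Space n → ℝ,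
      TugOfWar.IsDPPSolution Ω F α β γ ε u ∧
      (∀ v : TugOfWar.Space n → ℝ, TugOfWar.IsDPPSolution Ω F α β γ ε v →
        ∀ x ∈ TugOfWar.extDomain Ω ε, v x = u x) ∧
      ∀ x ∈ TugOfWar.extDomain Ω ε,
        u x = TugOfWar.valueI Ω F α γ ε x ∧ u x = TugOfWar.valueII Ω F α γ ε x := by
  have hα1 : α < 1 := by linarith
  have hl : 0 ≤ 1 - γ * ε ^ 2 := by linarith
  have hl1 : 1 - γ * ε ^ 2 ≤ 1 := by linarith [mul_nonneg hγ (sq_nonneg ε)]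
  have hΩ := hΩ_open.measurableSet
  have hstrip := measurableSet_strip hΩ_open ε
  have hext : MeasurableSet (extDomain Ω ε) := hΩ.union hstrip
  have hball : ∀ x ∈ Ω, ball x ε ⊆ extDomain Ω ε := fun x hx y hy => mem_extDomain_of_dist_lt hx hy
  obtain ⟨C, hC, hF⟩ : ∃ C : ℝ, 0 ≤ C ∧ ∀ x ∈ strip Ω ε, |F x| ≤ C := by
    obtain ⟨C, hC⟩ := hF_bdd
    exact ⟨max C 0, le_max_right _ _, fun x hx => (hC x hx).trans (le_max_left _ _)⟩
  have hval : ∀ v, IsDPPSolution Ω F α β γ ε v → ∀ x ∈ extDomain Ω ε,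
      v x = valueI Ω F α γ ε x ∧ v x = valueII Ω F α γ ε x := by
    intro v hv x hx
    obtain ⟨D, hD⟩ := hv.bounded
    have hD0 : 0 ≤ D := (abs_nonneg _).trans (hD x hx)
    -- Extension by zero makes `v` Borel and bounded everywhere. The DPP survives, because balls
    -- centred in `Ω` stay in the extended domain.
    have hcongr : ∀ y ∈ extDomain Ω ε, (extDomain Ω ε).indicator v y = v y :=
      fun y hy => indicator_of_mem hy v
    rw [← hcongr x hx]
    refine value_eq hn hΩ hΩ_bdd hα.le hα1 hαβ hε hl hl1 hC hF
      (measurable_indicator_of_measurable_restrict hext hv.measurable)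
      (abs_indicator_le hD0 hD) (fun y hy => ?_) (fun y hy => ?_) hx
    · rw [hcongr y (Or.inr hy), hv.boundary y hy]
    · rw [hcongr y (Or.inl hy), dppOp_congr fun z hz => hcongr z (hball y hy hz)]
      exact hv.dpp y hy
  obtain ⟨u, hum, huC, hu, huoff⟩ := exists_dppOp_fixed_point (G := (strip Ω ε).indicator F) hΩ
    hΩ_bdd hα.le hβ hαβ hε hl hl1 (measurable_indicator_of_measurable_restrict hstrip hF_meas)
    (abs_indicator_le hC hF)
  have hsol : IsDPPSolution Ω F α β γ ε u :=
    { measurable := hum.comp measurable_subtype_coe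
      bounded := ⟨C, fun x _ => huC x⟩
      dpp := hu
      boundary := fun x hx => by rw [huoff x hx.1, indicator_of_mem hx] }
  exact ⟨u, hsol, fun v hv x hx => (hval v hv x hx).1.trans (hval u hsol x hx).1.symm,
    fun x hx => hval u hsol x hx⟩
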